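/- Let $\Gamma=(V,E)$ be a finite simple graph and let $\mathcal A=\{(x,y),(y,x) : \{x,y\}\in E\}$ be its set of arcs; write $o(a)$, $t(a)$, $a^{-1}$ for the origin, terminus and inverse of an arc $a$. Define the matrices $d\in\mathbb C^{V\times\mathcal A}$ by $d_{x,a}=\frac{1}{\sqrt{\deg x}}\,\delta_{x,t(a)}$, $R\in\mathbb C^{\mathcal A\times\mathcal A}$ by $R_{a,b}=\delta_{a,b^{-1}}$, and $U=R(2d^*d-I)$ (the time evolution matrix of the Grover walk on $\Gamma$). A state is a vector $\Phi\in\mathbb C^{\mathcal A}$ with $\|\Phi\|=1$; it is of vertex type if $\Phi=d^*e_x$ for some $x\in V$, where $e_x$ is the standard unit vector at $x$. For distinct states $\Phi,\Psi$ and an integer $\tau\ge 1$, perfect state transfer occurs from $\Phi$ to $\Psi$ at time $\tau$ if $U^\tau\Phi=\gamma\Psi$ for some $\gamma\in\mathbb C$ with $|\gamma|=1$. The graph $\Gamma$ admits perfect state transfer if perfect state transfer occurs, at some time, between two distinct vertex type states. **Proposition.** Let $\Gamma$ be a connected $k$-regular graph whose adjacency matrix has set of distinct eigenvalues $\{k,\frac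 k2,-\frac k2,0\}$. If $\Gamma$ admits perfect state transfer, then the minimal time $\tau\ge 1$ at which perfect state transfer occurs between two distinct vertex type states of $\Gamma$ is either $6$ or $12$. Moreover, for every pair of distinct vertex type states $\Phi,\Psi$ such that perfect state transfer occurs from $\Phi$ to $\Psi$ at some time, the minimal time at which it occurs from $\Phi$ to $\Psi$ is either $6$ or $12$. -/

import Mathlib

open scoped Matrix

noncomputable section

namespace GroverWalk

variable {V : Type*} [Fintype V] [DecidableEq V] (G : SimpleGraph V) [DecidableRel G.Adj]

/-- The boundary matrix `d`: rows are vertices, columns are the symmetric arcs (darts) of `G`, and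
`d x a = 1 / √(deg x)` if `x` is the terminus of `a`, and `0` otherwise. -/
def boundaryMatrix : Matrix V G.Dart ℂ :=
  Matrix.of fun x a => if x = a.snd then ((1 / Real.sqrt (G.degree x) : ℝ) : ℂ) else 0

/-- The shift matrix `R`: `R a b = 1` if `a` is the inverse arc of `b`, and `0` otherwise. -/
def shiftMatrix : Matrix G.Dart G.Dart ℂ :=
  Matrix.of fun a b => if a = b.symm then 1 else 0

/-- The time evolution matrix `U = R (2 d* d - I)` of the Grover walk. -/
def timeEvolution : Matrix G.Dart G.Dart ℂ :=
  shiftMatrix G * ((2 : ℂ) • ((boundaryMatrix G)ᴴ * boundaryMatrix G) - 1)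

/-- A state is a vector on the arcs of Euclidean (ℓ²) norm one. -/
def IsState (Φ : G.Dart → ℂ) : Prop :=
  ‖WithLp.toLp 2 Φ‖ = 1

/-- A state is of vertex type if it is `d* e_x` for some vertex `x`. -/
def IsVertexTypeState (Φ : G.Dart → ℂ) : Prop :=
  IsState G Φ ∧ ∃ x : V, Φ = (boundaryMatrix G)ᴴ *ᵥ Pi.single x 1

/-- Perfect state transfer from the state `Φ` to the distinct state `Ψ` at time `τ ≥ 1`. -/
def PSTOccurs (Φ Ψ : G.Dart → ℂ) (τ : ℕ) : Prop :=
  IsState G Φ ∧ IsState G Ψ ∧ Φ ≠ Ψ ∧ 1 ≤ τ ∧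
    ∃ γ : ℂ, ‖γ‖ = 1 ∧ (timeEvolution G ^ τ) *ᵥ Φ = γ • Ψ

/-- The times at which perfect state transfer occurs between two distinct vertex type states. -/
def pstTimes : Set ℕ :=
  {τ | ∃ Φ Ψ : G.Dart → ℂ, IsVertexTypeState G Φ ∧ IsVertexTypeState G Ψ ∧ PSTOccurs G Φ Ψ τ}

/-- `G` admits perfect state transfer if it occurs, at some time, between two distinct
vertex type states. -/
def AdmitsPST : Prop :=
  ∃ Φ Ψ : G.Dart → ℂ, IsVertexTypeState G Φ ∧ IsVertexTypeState G Ψ ∧ ∃ τ : ℕ, PSTOccurs G Φ Ψ τ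

end GroverWalk

end

/-! Since `d d* = 1`, compressing the walk to the vertices gives `d U^n d* = T_n(P)`, with `P = A /
k` and `T_n` the Chebyshev polynomial (`boundaryMatrix_timeEvolution_pow_conjTranspose`). As `U` is
unitary and `d*` isometric, transfer from `x` to `y` at time `n` amounts to `T_n(P) e_x = e_y`; the
phase must be 1 because the columns of `T_n(P)` sum to 1.

The eigenvalues of `P` are cosines of 0, π/3, 2π/3, π/2, so `T_n(P)` depends only on `n` mod 12. Let
`a, b, c, d` be the squared norms of the projections of `e_x` to the eigenspaces of 1, 1/2, -1/2, 0.
They sum to 1, `a > 0`, and `P x x = 0` gives `a + b/2 - c/2 = 0`. Vanishing of the `(x, x)` entry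
of `T_n(P)` and unit norm of its column `x` then exclude every residue but 6
(`mod_twelve_of_chebMatrix_col`). At that residue `T_n(P) = T_6(P)`, so transfer already occurs at
time 6: the minimum is always 6. -/

namespace GroverWalk

/-! ### Scalar Chebyshev sequences -/

/-- The values `T_n(c)` of the Chebyshev polynomials of the first kind. -/
def chebValue (c : ℝ) : ℕ → ℝ
  | 0 => 1
  | 1 => c
  | n + 2 => 2 * c * chebValue c (n + 1) - chebValue c n

/-- A Chebyshev sequence that returns to its initial data after `N` steps is `N`-periodic. -/
theorem chebValue_add_period {c : ℝ} {N : ℕ} (h0 : chebValue c N = 1)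
    (h1 : chebValue c (N + 1) = c) (n : ℕ) : chebValue c (n + N) = chebValue c n := by
  have key : ∀ n, chebValue c (n + N) = chebValue c n ∧
      chebValue c (n + 1 + N) = chebValue c (n + 1) := by
    intro n
    induction n with
    | zero => exact ⟨by simpa [chebValue] using h0, by simpa [chebValue, add_comm] using h1⟩
    | succ n ih =>
      refine ⟨ih.2, ?_⟩
      have e : n + 1 + 1 + N = (n + N) + 2 := by ring
      have e' : n + N + 1 = n + 1 + N := by ring
      rw [e, chebValue, e', ih.1, ih.2, chebValue]
  exact (key n).1

theorem chebValue_mod {c : ℝ} {N : ℕ} (h0 : chebValue c N = 1)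
    (h1 : chebValue c (N + 1) = c) (n : ℕ) : chebValue c n = chebValue c (n % N) := by
  have key : ∀ q, chebValue c (n % N + N * q) = chebValue c (n % N) := by
    intro q
    induction q with
    | zero => simp
    | succ q ih => rw [Nat.mul_succ, ← add_assoc, chebValue_add_period h0 h1, ih]
  rw [← key (n / N), Nat.mod_add_div]

/-- The sequences `cos (nθ)` for θ = 0, π/3, 2π/3, π/2 have periods 1, 6, 3, 4, with least common
multiple 12. -/
theorem chebValue_mod_twelve {c : ℝ} (hc : c = 1 ∨ c = 1 / 2 ∨ c = -1 / 2 ∨ c = 0) (n : ℕ) :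
    chebValue c n = chebValue c (n % 12) := by
  apply chebValue_mod <;> rcases hc with rfl | rfl | rfl | rfl <;> norm_num [chebValue]

/-! ### Chebyshev sequences of matrices -/

section Cheb

variable {V : Type*} [Fintype V] [DecidableEq V]

/-- The matrices `T_n(P)`, for the Chebyshev polynomials of the first kind. -/
def chebMatrix (P : Matrix V V ℝ) : ℕ → Matrix V V ℝ
  | 0 => 1
  | 1 => P
  | n + 2 => (2 : ℝ) • (P * chebMatrix P (n + 1)) - chebMatrix P n

theorem chebMatrix_mul_of_mul_eq_smul {P E : Matrix V V ℝ} {c : ℝ} (h : P * E = c • E) (n : ℕ) :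
    chebMatrix P n * E = chebValue c n • E := by
  have key : chebMatrix P n * E = chebValue c n • E ∧
      chebMatrix P (n + 1) * E = chebValue c (n + 1) • E := by
    induction n with
    | zero => simp [chebMatrix, chebValue, h]
    | succ n ih =>
      refine ⟨ih.2, ?_⟩
      rw [chebMatrix, chebValue, sub_mul, smul_mul_assoc, mul_assoc, ih.1, ih.2, mul_smul_comm, h]
      module
  exact key.1

theorem commute_chebMatrix (P : Matrix V V ℝ) (n : ℕ) : Commute P (chebMatrix P n) := by
  have key : Commute P (chebMatrix P n) ∧ Commute P (chebMatrix P (n + 1)) := by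
    induction n with
    | zero => exact ⟨Commute.one_right _, Commute.refl _⟩
    | succ n ih =>
      refine ⟨ih.2, ?_⟩
      rw [chebMatrix]
      exact (((Commute.refl P).mul_right ih.2).smul_right _).sub_right ih.1
  exact key.1

theorem chebMatrix_transpose {P : Matrix V V ℝ} (hP : Pᵀ = P) (n : ℕ) :
    (chebMatrix P n)ᵀ = chebMatrix P n := by
  have key : (chebMatrix P n)ᵀ = chebMatrix P n ∧
      (chebMatrix P (n + 1))ᵀ = chebMatrix P (n + 1) := by
    induction n with
    | zero => simp [chebMatrix, hP]
    | succ n ih =>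
      refine ⟨ih.2, ?_⟩
      rw [chebMatrix, Matrix.transpose_sub, Matrix.transpose_smul, Matrix.transpose_mul, ih.1, ih.2,
        hP, (commute_chebMatrix P (n + 1)).eq]
  exact key.1

theorem one_vecMul_chebMatrix {P : Matrix V V ℝ} (hP : (1 : V → ℝ) ᵥ* P = 1) (n : ℕ) :
    (1 : V → ℝ) ᵥ* chebMatrix P n = 1 := by
  have key : (1 : V → ℝ) ᵥ* chebMatrix P n = 1 ∧ (1 : V → ℝ) ᵥ* chebMatrix P (n + 1) = 1 := by
    induction n with
    | zero => simp [chebMatrix, hP]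
    | succ n ih =>
      refine ⟨ih.2, ?_⟩
      rw [chebMatrix, Matrix.vecMul_sub, Matrix.vecMul_smul, ← Matrix.vecMul_vecMul, hP, ih.1, ih.2]
      module
  exact key.1

/-- For an orthogonal projection, `E x x` is the squared norm of column `x`. -/
theorem diag_nonneg_of_symm_idempotent {E : Matrix V V ℝ} (hs : Eᵀ = E) (hi : E * E = E) (x : V) :
    0 ≤ E x x := by
  rw [← hi]
  nth_rewrite 1 [← hs]
  simp only [Matrix.mul_apply, Matrix.transpose_apply]
  exact Finset.sum_nonneg fun z _ => mul_self_nonneg _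

theorem col_eq_zero_of_diag_eq_zero {E : Matrix V V ℝ} (hs : Eᵀ = E) (hi : E * E = E) {x : V}
    (h : E x x = 0) (z : V) : E z x = 0 := by
  rw [← hi] at h
  nth_rewrite 1 [← hs] at h
  simp only [Matrix.mul_apply, Matrix.transpose_apply] at h
  rw [Finset.sum_eq_zero_iff_of_nonneg fun z _ => mul_self_nonneg _] at h
  exact mul_self_eq_zero.mp (h z (Finset.mem_univ z))

/-- For a matrix annihilated by `X (X - 1) (4 X² - 1)`, the spectral idempotents. -/
theorem exists_spectral_idempotents {P : Matrix V V ℝ} (hP : Pᵀ = P)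
    (h4 : (4 : ℝ) • P ^ 4 = (4 : ℝ) • P ^ 3 + P ^ 2 - P) (h1 : (1 : V → ℝ) ᵥ* P = 1) :
    ∃ A B C D : Matrix V V ℝ, (Aᵀ = A ∧ A * A = A ∧ P * A = (1 : ℝ) • A) ∧
      (Bᵀ = B ∧ B * B = B ∧ P * B = (1 / 2 : ℝ) • B) ∧
      (Cᵀ = C ∧ C * C = C ∧ P * C = (-1 / 2 : ℝ) • C) ∧
      (Dᵀ = D ∧ D * D = D ∧ P * D = (0 : ℝ) • D) ∧
      A + B + C + D = 1 ∧ (1 : V → ℝ) ᵥ* A = 1 := by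
  have h4' : P * P ^ 3 = P ^ 3 + (1 / 4 : ℝ) • P ^ 2 - (1 / 4 : ℝ) • P := by
    have : P * P ^ 3 = (1 / 4 : ℝ) • ((4 : ℝ) • P ^ 4) := by
      rw [smul_smul, ← pow_succ']; norm_num
    rw [this, h4]; module
  have h3 : P * P ^ 2 = P ^ 3 := by rw [← pow_succ']
  have h2 : P * P = P ^ 2 := (sq P).symm
  have mulP : ∀ a b c e : ℝ, P * (a • P ^ 3 + b • P ^ 2 + c • P + e • 1) =
      (a + b) • P ^ 3 + (a / 4 + c) • P ^ 2 + (e - a / 4) • P := by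
    intro a b c e
    simp only [mul_add, mul_smul_comm, h4', h3, h2, mul_one]
    module
  have idem : ∀ (a b c e t : ℝ) (E : Matrix V V ℝ),
      E = a • P ^ 3 + b • P ^ 2 + c • P + e • 1 → P * E = t • E →
      a * t ^ 3 + b * t ^ 2 + c * t + e = 1 → E * E = E := by
    intro a b c e t E hE ht hv
    have ht2 : P ^ 2 * E = (t ^ 2) • E := by
      rw [sq, mul_assoc, ht, mul_smul_comm, ht]; module
    have ht3 : P ^ 3 * E = (t ^ 3) • E := by
      rw [pow_succ, mul_assoc, ht, mul_smul_comm, ht2]; module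
    calc E * E = (a • P ^ 3 + b • P ^ 2 + c • P + e • 1) * E := by rw [← hE]
      _ = (a * t ^ 3 + b * t ^ 2 + c * t + e) • E := by
        simp only [add_mul, smul_mul_assoc, ht, ht2, ht3, one_mul]; module
      _ = E := by rw [hv, one_smul]
  have symm : ∀ a b c e : ℝ, (a • P ^ 3 + b • P ^ 2 + c • P + e • (1 : Matrix V V ℝ))ᵀ =
      a • P ^ 3 + b • P ^ 2 + c • P + e • 1 := by
    intro a b c e
    simp [Matrix.transpose_pow, hP]
  have build : ∀ a b c e t : ℝ, a + b = t * a → a / 4 + c = t * b → e - a / 4 = t * c →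
      0 = t * e → a * t ^ 3 + b * t ^ 2 + c * t + e = 1 →
      ((a • P ^ 3 + b • P ^ 2 + c • P + e • (1 : Matrix V V ℝ))ᵀ =
      a • P ^ 3 + b • P ^ 2 + c • P + e • 1 ∧ (a • P ^ 3 + b • P ^ 2 + c • P + e • 1) *
      (a • P ^ 3 + b • P ^ 2 + c • P + e • 1) = a • P ^ 3 + b • P ^ 2 + c • P + e • 1 ∧
      P * (a • P ^ 3 + b • P ^ 2 + c • P + e • 1) =
      t • (a • P ^ 3 + b • P ^ 2 + c • P + e • 1)) := by
    intro a b c e t e3 e2 e1 e0 hv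
    have hm : P * (a • P ^ 3 + b • P ^ 2 + c • P + e • 1) =
        t • (a • P ^ 3 + b • P ^ 2 + c • P + e • 1) := by
      rw [mulP, e3, e2, e1]
      simp only [smul_add, smul_smul, ← e0]
      simp
    exact ⟨symm a b c e, idem a b c e t _ rfl hm hv, hm⟩
  -- The Lagrange interpolation polynomials at the nodes 1, 1/2, -1/2, 0, evaluated at `P`.
  refine ⟨(4 / 3 : ℝ) • P ^ 3 + (0 : ℝ) • P ^ 2 + (-1 / 3 : ℝ) • P + (0 : ℝ) • 1,
    (-4 : ℝ) • P ^ 3 + (2 : ℝ) • P ^ 2 + (2 : ℝ) • P + (0 : ℝ) • 1,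
    (-4 / 3 : ℝ) • P ^ 3 + (2 : ℝ) • P ^ 2 + (-2 / 3 : ℝ) • P + (0 : ℝ) • 1,
    (4 : ℝ) • P ^ 3 + (-4 : ℝ) • P ^ 2 + (-1 : ℝ) • P + (1 : ℝ) • 1,
    build _ _ _ _ _ ?_ ?_ ?_ ?_ ?_, build _ _ _ _ _ ?_ ?_ ?_ ?_ ?_,
    build _ _ _ _ _ ?_ ?_ ?_ ?_ ?_, build _ _ _ _ _ ?_ ?_ ?_ ?_ ?_, ?_, ?_⟩
  -- Goals 1 to 20 are the coefficient identities of the four `build` calls.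
  on_goal 21 => module
  on_goal 21 =>
    have hp3 : (1 : V → ℝ) ᵥ* P ^ 3 = 1 := by
      rw [pow_succ, sq, ← Matrix.vecMul_vecMul, ← Matrix.vecMul_vecMul, h1, h1, h1]
    simp only [Matrix.vecMul_add, Matrix.vecMul_smul, hp3, h1, zero_smul, Matrix.vecMul_zero]
    module
  all_goals norm_num

/-- If `T_n(P)` moves a basis vector to another one, for a symmetric stochastic `P` with zero
diagonal, nonzero columns and eigenvalues among `1, 1/2, -1/2, 0`, then `n ≡ 6` modulo `12`. -/
theorem mod_twelve_of_chebMatrix_col {P : Matrix V V ℝ} (hP : Pᵀ = P)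
    (h4 : (4 : ℝ) • P ^ 4 = (4 : ℝ) • P ^ 3 + P ^ 2 - P) (h1 : (1 : V → ℝ) ᵥ* P = 1)
    {x y : V} (hxx : P x x = 0) (hxy : x ≠ y) {n : ℕ}
    (h : (chebMatrix P n).col x = Pi.single y 1) :
    n % 12 = 6 ∧ (chebMatrix P 6).col x = Pi.single y 1 := by
  obtain ⟨A, B, C, D, ⟨sA, iA, pA⟩, ⟨sB, iB, pB⟩, ⟨sC, iC, pC⟩, ⟨sD, iD, pD⟩, hsum, hA⟩ :=
    exists_spectral_idempotents hP h4 h1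
  have expand : ∀ m, chebMatrix P m = chebValue 1 m • A + chebValue (1 / 2) m • B +
      chebValue (-1 / 2) m • C + chebValue 0 m • D := by
    intro m
    rw [← chebMatrix_mul_of_mul_eq_smul pA, ← chebMatrix_mul_of_mul_eq_smul pB,
      ← chebMatrix_mul_of_mul_eq_smul pC, ← chebMatrix_mul_of_mul_eq_smul pD, ← mul_add, ← mul_add,
      ← mul_add, hsum, mul_one]
  have expand_sq : chebMatrix P n * chebMatrix P n = chebValue 1 n ^ 2 • A +
      chebValue (1 / 2) n ^ 2 • B + chebValue (-1 / 2) n ^ 2 • C + chebValue 0 n ^ 2 • D := by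
    nth_rewrite 2 [expand n]
    simp only [mul_add, mul_smul_comm, chebMatrix_mul_of_mul_eq_smul pA,
      chebMatrix_mul_of_mul_eq_smul pB, chebMatrix_mul_of_mul_eq_smul pC,
      chebMatrix_mul_of_mul_eq_smul pD, smul_smul, sq]
  have hcol : ∀ z, chebMatrix P n z x = (Pi.single y 1 : V → ℝ) z := fun z => congrFun h z
  have hn0 : chebMatrix P n x x = 0 := by rw [hcol]; simp [hxy]
  have hn1 : (chebMatrix P n * chebMatrix P n) x x = 1 := by
    nth_rewrite 1 [← chebMatrix_transpose hP n]
    simp [Matrix.mul_apply, hcol, Pi.single_apply]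
  have hw : A x x + B x x + C x x + D x x = 1 := by
    simpa using congrFun (congrFun hsum x) x
  -- The expansion of `T_1(P) = P` on the diagonal.
  have hp : A x x + 1 / 2 * B x x - 1 / 2 * C x x = 0 := by
    have := congrFun (congrFun (expand 1) x) x
    simp only [chebMatrix, hxx, chebValue, Matrix.add_apply, Matrix.smul_apply, smul_eq_mul] at this
    linarith
  -- Otherwise column `x` of `A` would vanish, yet it sums to 1.
  have hApos : 0 < A x x := by
    refine lt_of_le_of_ne (diag_nonneg_of_symm_idempotent sA iA x) fun h0 => ?_
    have := congrFun hA x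
    simp [Matrix.vecMul, dotProduct, col_eq_zero_of_diag_eq_zero sA iA h0.symm] at this
  have hB := diag_nonneg_of_symm_idempotent sB iB x
  have hC := diag_nonneg_of_symm_idempotent sC iC x
  have hD := diag_nonneg_of_symm_idempotent sD iD x
  rw [expand n] at hn0
  rw [expand_sq] at hn1
  simp only [Matrix.add_apply, Matrix.smul_apply, smul_eq_mul] at hn0 hn1
  have e1 := chebValue_mod_twelve (c := 1) (by simp) n
  have e2 := chebValue_mod_twelve (c := 1 / 2) (by simp) n
  have e3 := chebValue_mod_twelve (c := -1 / 2) (by simp) n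
  have e4 := chebValue_mod_twelve (c := 0) (by simp) n
  have hmod : n % 12 = 6 := by
    rw [e1, e2, e3, e4] at hn0 hn1
    have hlt := Nat.mod_lt n (show 12 > 0 by norm_num)
    generalize n % 12 = r at *
    by_contra hr
    clear e1 e2 e3 e4
    -- For `3 ∤ r` the values at ±1/2 are ±1/2, so unit norm forces `b = c = 0`, hence `a = 0`. For
    -- `r = 3, 9` it forces `d = 0`; then `a - b + c = 0` and `hp` give `a = 0`. For `r = 0` the
    -- diagonal entry is 1.
    interval_cases r <;> norm_num [chebValue] at hn0 hn1 hr <;> linarith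
  refine ⟨hmod, ?_⟩
  rw [hmod] at e1 e2 e3 e4
  rw [expand 6, ← e1, ← e2, ← e3, ← e4, ← expand n, h]

end Cheb

/-! ### The transition matrix of a regular graph -/

section Walk

variable {V : Type*} [Fintype V] [DecidableEq V] (G : SimpleGraph V) [DecidableRel G.Adj]

/-- The transition matrix of the simple random walk on a `k`-regular graph. -/
noncomputable def transitionMatrix (k : ℕ) : Matrix V V ℝ := (1 / (k : ℝ)) • G.adjMatrix ℝ

theorem transitionMatrix_transpose (k : ℕ) : (transitionMatrix G k)ᵀ = transitionMatrix G k := by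
  simp [transitionMatrix]

theorem transitionMatrix_apply_self (k : ℕ) (x : V) : transitionMatrix G k x x = 0 := by
  simp [transitionMatrix]

variable {G} {k : ℕ}

theorem one_vecMul_transitionMatrix (hreg : G.IsRegularOfDegree k) (hk : k ≠ 0) :
    (1 : V → ℝ) ᵥ* transitionMatrix G k = 1 := by
  ext x
  have : (k : ℝ) ≠ 0 := by exact_mod_cast hk
  rw [transitionMatrix, Matrix.vecMul_smul]
  have hdeg := hreg.degree_eq x
  rw [← SimpleGraph.card_neighborFinset_eq_degree, SimpleGraph.neighborFinset_eq_filter] at hdeg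
  simp [Matrix.vecMul, dotProduct, SimpleGraph.adjMatrix_apply, G.adj_comm _ x, hdeg, this]

theorem spectrum_real_adjMatrix_mem {r : ℝ} (hr : r ∈ spectrum ℝ (G.adjMatrix ℝ)) :
    (r : ℂ) ∈ spectrum ℂ (G.adjMatrix ℂ) := by
  rw [spectrum.mem_iff, Matrix.isUnit_iff_isUnit_det] at hr ⊢
  have e : algebraMap ℂ (Matrix V V ℂ) (r : ℂ) - G.adjMatrix ℂ =
      (Complex.ofRealHom.mapMatrix) (algebraMap ℝ (Matrix V V ℝ) r - G.adjMatrix ℝ) := by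
    ext i j
    by_cases hij : i = j <;> by_cases hadj : G.Adj i j <;>
      simp [Matrix.algebraMap_matrix_apply, SimpleGraph.adjMatrix_apply, hij, hadj]
  rw [e, ← RingHom.map_det]
  simpa using hr

theorem transitionMatrix_quartic (hk : k ≠ 0)
    (hspec : spectrum ℂ (G.adjMatrix ℂ) = {(k : ℂ), (k : ℂ) / 2, -((k : ℂ) / 2), 0}) :
    (4 : ℝ) • transitionMatrix G k ^ 4 =
      (4 : ℝ) • transitionMatrix G k ^ 3 + transitionMatrix G k ^ 2 - transitionMatrix G k := by
  have hk' : (k : ℝ) ≠ 0 := by exact_mod_cast hk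
  have hA : IsSelfAdjoint (G.adjMatrix ℝ) := by
    rw [IsSelfAdjoint, Matrix.star_eq_conjTranspose]
    exact G.isHermitian_adjMatrix ℝ
  have hroot : ∀ r ∈ spectrum ℝ (G.adjMatrix ℝ),
      4 * r ^ 4 - 4 * k * r ^ 3 - k ^ 2 * r ^ 2 + k ^ 3 * r = 0 := by
    intro r hr
    have hm := spectrum_real_adjMatrix_mem hr
    rw [hspec] at hm
    simp only [Set.mem_insert_iff, Set.mem_singleton_iff] at hm
    have hm' : r = k ∨ r = k / 2 ∨ r = -(k / 2) ∨ r = 0 := by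
      refine hm.imp ?_ (Or.imp ?_ (Or.imp ?_ ?_)) <;> intro h <;> apply Complex.ofReal_injective <;>
        simpa using h
    rcases hm' with rfl | rfl | rfl | rfl <;> ring
  let q : Polynomial ℝ := (4 : ℝ) • Polynomial.X ^ 4 - (4 * (k : ℝ)) • Polynomial.X ^ 3 -
    ((k : ℝ) ^ 2) • Polynomial.X ^ 2 + ((k : ℝ) ^ 3) • Polynomial.X
  have hq : Polynomial.aeval (G.adjMatrix ℝ) q = 0 := by
    -- A self-adjoint matrix is annihilated by any polynomial vanishing on its spectrum, so
    -- multiplicities play no role.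
    rw [← cfc_polynomial q (G.adjMatrix ℝ) hA, ← cfc_zero ℝ (G.adjMatrix ℝ)]
    refine cfc_congr fun r hr => ?_
    simpa [q] using hroot r hr
  have hq' : (4 : ℝ) • G.adjMatrix ℝ ^ 4 - (4 * (k : ℝ)) • G.adjMatrix ℝ ^ 3 -
      ((k : ℝ) ^ 2) • G.adjMatrix ℝ ^ 2 + ((k : ℝ) ^ 3) • G.adjMatrix ℝ = 0 := by
    simpa only [q, map_add, map_sub, map_smul, map_pow, Polynomial.aeval_X] using hq
  have hA' : G.adjMatrix ℝ = (k : ℝ) • transitionMatrix G k := by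
    rw [transitionMatrix, smul_smul, mul_one_div_cancel hk', one_smul]
  rw [hA'] at hq'
  simp only [smul_pow, smul_smul] at hq'
  have hfin : ((k : ℝ) ^ 4) • ((4 : ℝ) • transitionMatrix G k ^ 4 - ((4 : ℝ) •
      transitionMatrix G k ^ 3 + transitionMatrix G k ^ 2 - transitionMatrix G k)) = 0 := by
    rw [← hq']; module
  exact sub_eq_zero.mp ((smul_eq_zero.mp hfin).resolve_left (pow_ne_zero _ hk'))

/-! ### The Grover walk seen from the vertices -/

variable (G) in
theorem shiftMatrix_mul_apply {ι : Type*} (M : Matrix G.Dart ι ℂ) (a : G.Dart) (i : ι) :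
    (shiftMatrix G * M) a i = M a.symm i := by
  rw [Matrix.mul_apply, Finset.sum_eq_single a.symm]
  · simp [shiftMatrix]
  · intro b _ hb
    have : a ≠ b.symm := fun h => hb (by rw [h, SimpleGraph.Dart.symm_symm])
    simp [shiftMatrix, this]
  · simp

variable (G) in
theorem shiftMatrix_mul_self : shiftMatrix G * shiftMatrix G = 1 := by
  ext a b
  rw [shiftMatrix_mul_apply]
  simp [shiftMatrix, Matrix.one_apply, SimpleGraph.Dart.symm_involutive.injective.eq_iff]

variable (G) in
theorem shiftMatrix_conjTranspose : (shiftMatrix G)ᴴ = shiftMatrix G := by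
  ext a b
  have : b = a.symm ↔ a = b.symm := by
    constructor <;> rintro rfl <;> simp
  simp [shiftMatrix, this, apply_ite]

theorem boundaryMatrix_apply (hreg : G.IsRegularOfDegree k) (x : V) (a : G.Dart) :
    boundaryMatrix G x a = if x = a.snd then ((1 / Real.sqrt k : ℝ) : ℂ) else 0 := by
  simp [boundaryMatrix, hreg.degree_eq x]

variable (G) in
theorem card_dart_snd_eq (x : V) :
    (Finset.univ.filter fun a : G.Dart => a.snd = x).card = G.degree x := by
  rw [← G.dart_fst_fiber_card_eq_degree x]
  refine Finset.card_nbij' SimpleGraph.Dart.symm SimpleGraph.Dart.symm ?_ ?_ ?_ ?_ <;>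
    intro a <;> simp

theorem inv_sqrt_mul_inv_sqrt (k : ℕ) :
    ((1 / Real.sqrt k : ℝ) : ℂ) * ((1 / Real.sqrt k : ℝ) : ℂ) = ((1 / (k : ℝ) : ℝ) : ℂ) := by
  rw [← Complex.ofReal_mul, div_mul_div_comm, Real.mul_self_sqrt (Nat.cast_nonneg k), one_mul]

theorem boundaryMatrix_mul_conjTranspose (hreg : G.IsRegularOfDegree k) (hk : k ≠ 0) :
    boundaryMatrix G * (boundaryMatrix G)ᴴ = 1 := by
  have hk' : (k : ℂ) ≠ 0 := by exact_mod_cast hk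
  ext x y
  have hterm : ∀ a : G.Dart, boundaryMatrix G x a * (boundaryMatrix G)ᴴ a y =
      if a.snd = x then (if x = y then ((1 / (k : ℝ) : ℝ) : ℂ) else 0) else 0 := by
    intro a
    rw [Matrix.conjTranspose_apply, boundaryMatrix_apply hreg, boundaryMatrix_apply hreg,
      ← inv_sqrt_mul_inv_sqrt]
    by_cases h : x = a.snd
    · subst h
      by_cases h' : y = a.snd
      · subst h'; simp
      · simp [h', Ne.symm h']
    · simp [h, Ne.symm h]
  rw [Matrix.mul_apply, Finset.sum_congr rfl fun a _ => hterm a, ← Finset.sum_filter,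
    Finset.sum_const, card_dart_snd_eq, hreg.degree_eq x, Matrix.one_apply]
  split_ifs <;> simp [hk']

theorem boundaryMatrix_shiftMatrix_conjTranspose (hreg : G.IsRegularOfDegree k) :
    boundaryMatrix G * shiftMatrix G * (boundaryMatrix G)ᴴ =
      Complex.ofRealHom.mapMatrix (transitionMatrix G k) := by
  ext x y
  have hterm : ∀ a : G.Dart, boundaryMatrix G x a * (shiftMatrix G * (boundaryMatrix G)ᴴ) a y =
      if x = a.snd ∧ y = a.fst then ((1 / (k : ℝ) : ℝ) : ℂ) else 0 := by
    intro a
    rw [shiftMatrix_mul_apply, Matrix.conjTranspose_apply, boundaryMatrix_apply hreg,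
      boundaryMatrix_apply hreg, ← inv_sqrt_mul_inv_sqrt]
    by_cases h : x = a.snd <;> by_cases h' : y = a.fst <;> simp [h, h']
  rw [Matrix.mul_assoc, Matrix.mul_apply, Finset.sum_congr rfl fun a _ => hterm a]
  by_cases hadj : G.Adj y x
  · rw [Finset.sum_eq_single ⟨(y, x), hadj⟩]
    · simp [transitionMatrix, hadj.symm]
    · intro b _ hb
      rw [if_neg]
      rintro ⟨rfl, rfl⟩
      exact hb rfl
    · simp
  · rw [Finset.sum_eq_zero]
    · simp [transitionMatrix, G.adj_comm x y, hadj]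
    · intro a _
      rw [if_neg]
      rintro ⟨rfl, rfl⟩
      exact hadj a.adj

/-- The reflection `2 d* d - 1` fixes the range of `d*`. -/
theorem timeEvolution_mul_conjTranspose (hreg : G.IsRegularOfDegree k) (hk : k ≠ 0) :
    timeEvolution G * (boundaryMatrix G)ᴴ = shiftMatrix G * (boundaryMatrix G)ᴴ := by
  rw [timeEvolution, Matrix.mul_assoc, Matrix.sub_mul, Matrix.smul_mul, Matrix.mul_assoc,
    boundaryMatrix_mul_conjTranspose hreg hk]
  simp [two_smul]

theorem boundaryMatrix_mul_timeEvolution (hreg : G.IsRegularOfDegree k) :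
    boundaryMatrix G * timeEvolution G =
      (2 : ℂ) • (Complex.ofRealHom.mapMatrix (transitionMatrix G k) * boundaryMatrix G) -
        boundaryMatrix G * shiftMatrix G := by
  rw [← boundaryMatrix_shiftMatrix_conjTranspose hreg, timeEvolution]
  simp only [Matrix.mul_sub, Matrix.mul_smul, Matrix.mul_one, Matrix.mul_assoc]

/-- The Chebyshev recurrence for `d U^n`: it follows from `d U = 2 P d - d R` and `d R U = d`. -/
theorem boundaryMatrix_mul_timeEvolution_sq (hreg : G.IsRegularOfDegree k) (hk : k ≠ 0) :
    boundaryMatrix G * (timeEvolution G * timeEvolution G) =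
      (2 : ℂ) • (Complex.ofRealHom.mapMatrix (transitionMatrix G k) *
        (boundaryMatrix G * timeEvolution G)) - boundaryMatrix G := by
  have hR : boundaryMatrix G * shiftMatrix G * timeEvolution G = boundaryMatrix G := by
    rw [timeEvolution, Matrix.mul_assoc, ← Matrix.mul_assoc (shiftMatrix G), shiftMatrix_mul_self,
      Matrix.one_mul, Matrix.mul_sub, Matrix.mul_smul, ← Matrix.mul_assoc,
      boundaryMatrix_mul_conjTranspose hreg hk, Matrix.one_mul, Matrix.mul_one, two_smul,
      add_sub_cancel_right]
  rw [← Matrix.mul_assoc]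
  nth_rewrite 1 [boundaryMatrix_mul_timeEvolution hreg]
  rw [Matrix.sub_mul, hR, Matrix.smul_mul, Matrix.mul_assoc]

/-- Compressing the powers of the time evolution to the vertices gives Chebyshev polynomials of
the transition matrix. -/
theorem boundaryMatrix_timeEvolution_pow_conjTranspose (hreg : G.IsRegularOfDegree k) (hk : k ≠ 0)
    (n : ℕ) : boundaryMatrix G * timeEvolution G ^ n * (boundaryMatrix G)ᴴ =
      Complex.ofRealHom.mapMatrix (chebMatrix (transitionMatrix G k) n) := by
  have key : (boundaryMatrix G * timeEvolution G ^ n * (boundaryMatrix G)ᴴ =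
      Complex.ofRealHom.mapMatrix (chebMatrix (transitionMatrix G k) n)) ∧
      boundaryMatrix G * timeEvolution G ^ (n + 1) * (boundaryMatrix G)ᴴ =
      Complex.ofRealHom.mapMatrix (chebMatrix (transitionMatrix G k) (n + 1)) := by
    induction n with
    | zero =>
      rw [pow_zero, Matrix.mul_one, boundaryMatrix_mul_conjTranspose hreg hk, zero_add, pow_one,
        Matrix.mul_assoc, timeEvolution_mul_conjTranspose hreg hk, ← Matrix.mul_assoc,
        boundaryMatrix_shiftMatrix_conjTranspose hreg]
      simp only [chebMatrix, map_one, true_and]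
    | succ n ih =>
      refine ⟨ih.2, ?_⟩
      have hsmul : ∀ M : Matrix V V ℝ, Complex.ofRealHom.mapMatrix ((2 : ℝ) • M) =
          (2 : ℂ) • Complex.ofRealHom.mapMatrix M := by
        intro M; ext; simp
      rw [chebMatrix, map_sub, hsmul, map_mul, ← ih.1, ← ih.2, pow_succ', pow_succ',
        ← Matrix.mul_assoc (timeEvolution G), ← Matrix.mul_assoc (boundaryMatrix G),
        boundaryMatrix_mul_timeEvolution_sq hreg hk]
      simp only [Matrix.sub_mul, Matrix.smul_mul, Matrix.mul_assoc]
  exact key.1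

theorem timeEvolution_conjTranspose_mul_self (hreg : G.IsRegularOfDegree k) (hk : k ≠ 0) :
    (timeEvolution G)ᴴ * timeEvolution G = 1 := by
  have hd := boundaryMatrix_mul_conjTranspose hreg hk
  set d := boundaryMatrix G with hdef
  have hproj : dᴴ * d * (dᴴ * d) = dᴴ * d := by
    rw [Matrix.mul_assoc, ← Matrix.mul_assoc d, hd, Matrix.one_mul]
  have hsymm : ((2 : ℂ) • (dᴴ * d) - 1)ᴴ = (2 : ℂ) • (dᴴ * d) - 1 := by
    simp [Matrix.conjTranspose_smul]
  rw [timeEvolution, Matrix.conjTranspose_mul, ← hdef, hsymm, shiftMatrix_conjTranspose,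
    Matrix.mul_assoc, ← Matrix.mul_assoc (shiftMatrix G), shiftMatrix_mul_self, Matrix.one_mul]
  simp only [Matrix.mul_sub, Matrix.sub_mul, Matrix.mul_smul, Matrix.smul_mul, hproj,
    Matrix.mul_one, Matrix.one_mul]
  module

theorem timeEvolution_pow_conjTranspose_mul_self (hreg : G.IsRegularOfDegree k) (hk : k ≠ 0)
    (n : ℕ) : (timeEvolution G ^ n)ᴴ * timeEvolution G ^ n = 1 := by
  induction n with
  | zero => simp
  | succ n ih =>
    rw [pow_succ', Matrix.conjTranspose_mul, Matrix.mul_assoc,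
      ← Matrix.mul_assoc _ (timeEvolution G), timeEvolution_conjTranspose_mul_self hreg hk,
      Matrix.one_mul, ih]

theorem mapMatrix_mulVec_single (M : Matrix V V ℝ) (x y : V) :
    (Complex.ofRealHom.mapMatrix M *ᵥ Pi.single x 1) y = (M y x : ℂ) := by
  simp

/-- If perfect state transfer occurs between the vertex type states at `x` and `y` at time `n`, then
`T_n(P)` maps `e_x` to `e_y`. -/
theorem chebMatrix_col_of_transfer (hreg : G.IsRegularOfDegree k) (hk : k ≠ 0) {x y : V} {n : ℕ}
    {γ : ℂ} (h : (timeEvolution G ^ n) *ᵥ ((boundaryMatrix G)ᴴ *ᵥ Pi.single x 1) =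
      γ • ((boundaryMatrix G)ᴴ *ᵥ Pi.single y 1)) :
    (chebMatrix (transitionMatrix G k) n).col x = Pi.single y 1 := by
  have h' : Complex.ofRealHom.mapMatrix (chebMatrix (transitionMatrix G k) n) *ᵥ Pi.single x 1 =
      γ • Pi.single y 1 := by
    have := congrArg (boundaryMatrix G *ᵥ ·) h
    simp only [Matrix.mulVec_smul, Matrix.mulVec_mulVec] at this
    rwa [boundaryMatrix_mul_conjTranspose hreg hk, Matrix.one_mulVec, ← Matrix.mul_assoc,
      boundaryMatrix_timeEvolution_pow_conjTranspose hreg hk] at this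
  have hoff : ∀ z, z ≠ y → chebMatrix (transitionMatrix G k) n z x = 0 := by
    intro z hz
    have := congrFun h' z
    rw [mapMatrix_mulVec_single] at this
    simpa [hz] using this
  -- The only possibly nonzero entry of the column equals the column sum 1, which removes the phase.
  have hsum := congrFun (one_vecMul_chebMatrix (one_vecMul_transitionMatrix hreg hk) n) x
  simp only [Matrix.vecMul, dotProduct, Pi.one_apply, one_mul] at hsum
  rw [Finset.sum_eq_single y (fun z _ hz => hoff z hz) (by simp)] at hsum
  ext z
  by_cases hz : z = y
  · subst hz; simpa using hsum
  · simpa [hz] using hoff z hz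

/-- Conversely, if `T_n(P)` maps `e_x` to `e_y`, the walk maps the vertex type state at `x` to the
one at `y`. -/
theorem transfer_of_chebMatrix_col (hreg : G.IsRegularOfDegree k) (hk : k ≠ 0) {x y : V} {n : ℕ}
    (h : (chebMatrix (transitionMatrix G k) n).col x = Pi.single y 1) :
    (timeEvolution G ^ n) *ᵥ ((boundaryMatrix G)ᴴ *ᵥ Pi.single x 1) =
      (boundaryMatrix G)ᴴ *ᵥ Pi.single y 1 := by
  have hd := boundaryMatrix_mul_conjTranspose hreg hk
  have hT := boundaryMatrix_timeEvolution_pow_conjTranspose hreg hk n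
  have hU := timeEvolution_pow_conjTranspose_mul_self hreg hk n
  set d := boundaryMatrix G
  set W := timeEvolution G ^ n
  set u := W *ᵥ (dᴴ *ᵥ Pi.single x 1) with hu
  have hdu : d *ᵥ u = Pi.single y 1 := by
    rw [hu, Matrix.mulVec_mulVec, Matrix.mulVec_mulVec, hT]
    ext z
    rw [mapMatrix_mulVec_single]
    have := congrFun h z
    simp only [Matrix.col_apply] at this
    rw [this]
    by_cases hz : z = y
    · subst hz; simp
    · simp [hz]
  have huu : star u ⬝ᵥ u = 1 := by
    rw [hu, Matrix.star_mulVec, Matrix.dotProduct_mulVec, Matrix.vecMul_vecMul, hU,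
      Matrix.vecMul_one, Matrix.star_mulVec, Matrix.conjTranspose_conjTranspose,
      Matrix.dotProduct_mulVec, Matrix.vecMul_vecMul, hd, Matrix.vecMul_one]
    simp
  have huv : star u ⬝ᵥ (dᴴ *ᵥ Pi.single y 1) = 1 := by
    rw [Matrix.dotProduct_mulVec, ← Matrix.star_mulVec, hdu]
    simp
  have hvu : star (dᴴ *ᵥ Pi.single y 1) ⬝ᵥ u = 1 := by
    rw [Matrix.star_mulVec, Matrix.conjTranspose_conjTranspose, ← Matrix.dotProduct_mulVec, hdu]
    simp
  have hvv : star (dᴴ *ᵥ (Pi.single y 1 : V → ℂ)) ⬝ᵥ (dᴴ *ᵥ Pi.single y 1) = 1 := by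
    rw [Matrix.star_mulVec, Matrix.conjTranspose_conjTranspose, ← Matrix.dotProduct_mulVec,
      Matrix.mulVec_mulVec, hd, Matrix.one_mulVec]
    simp
  -- Equality case of Cauchy–Schwarz: unit vectors with inner product 1 are at distance 0.
  open scoped ComplexOrder in
  rw [← sub_eq_zero, ← dotProduct_star_self_eq_zero, star_sub,
    sub_dotProduct, dotProduct_sub, dotProduct_sub, huu, huv, hvu, hvv]
  norm_num

/-- For `k = 0` the convention `1 / 0 = 0` makes `d` zero, so `d* e_x` cannot have norm 1. -/
theorem degree_ne_zero_of_isState (hreg : G.IsRegularOfDegree k) {x : V}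
    (h : IsState G ((boundaryMatrix G)ᴴ *ᵥ Pi.single x 1)) : k ≠ 0 := by
  rintro rfl
  have h0 : boundaryMatrix G = 0 := by
    ext z a
    simp [boundaryMatrix_apply hreg]
  rw [IsState, h0, Matrix.conjTranspose_zero, Matrix.zero_mulVec, WithLp.toLp_zero, norm_zero] at h
  exact zero_ne_one h

/-- Perfect state transfer between vertex type states occurs only at times congruent to `6` modulo
`12`, and then also at time `6`. -/
theorem PSTOccurs.mod_twelve (hreg : G.IsRegularOfDegree k)
    (hspec : spectrum ℂ (G.adjMatrix ℂ) = {(k : ℂ), (k : ℂ) / 2, -((k : ℂ) / 2), 0})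
    {Φ Ψ : G.Dart → ℂ} (hΦ : IsVertexTypeState G Φ) (hΨ : IsVertexTypeState G Ψ) {n : ℕ}
    (h : PSTOccurs G Φ Ψ n) : n % 12 = 6 ∧ PSTOccurs G Φ Ψ 6 := by
  obtain ⟨sΦ, x, rfl⟩ := hΦ
  obtain ⟨sΨ, y, rfl⟩ := hΨ
  obtain ⟨-, -, hne, -, γ, -, hγ⟩ := h
  have hk := degree_ne_zero_of_isState hreg sΦ
  obtain ⟨hmod, h6⟩ := mod_twelve_of_chebMatrix_col (transitionMatrix_transpose G k)
    (transitionMatrix_quartic hk hspec) (one_vecMul_transitionMatrix hreg hk)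
    (transitionMatrix_apply_self G k x) (fun hxy => hne (by rw [hxy]))
    (chebMatrix_col_of_transfer hreg hk hγ)
  exact ⟨hmod, sΦ, sΨ, hne, by norm_num, 1, by simp, by
    rw [one_smul]; exact transfer_of_chebMatrix_col hreg hk h6⟩

end Walk

end GroverWalk

theorem mainTheorem9 {V : Type*} [Fintype V] [DecidableEq V] (G : SimpleGraph V)
    [DecidableRel G.Adj] (k : ℕ) (hconn : G.Connected) (hreg : G.IsRegularOfDegree k)
    (hspec : spectrum ℂ (G.adjMatrix ℂ) = {(k : ℂ), (k : ℂ) / 2, -((k : ℂ) / 2), 0})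
    (hpst : GroverWalk.AdmitsPST G) :
    (IsLeast (GroverWalk.pstTimes G) 6 ∨ IsLeast (GroverWalk.pstTimes G) 12) ∧
    ∀ Φ Ψ : G.Dart → ℂ, GroverWalk.IsVertexTypeState G Φ → GroverWalk.IsVertexTypeState G Ψ →
      (∃ τ : ℕ, GroverWalk.PSTOccurs G Φ Ψ τ) →
        (IsLeast {τ : ℕ | GroverWalk.PSTOccurs G Φ Ψ τ} 6 ∨
          IsLeast {τ : ℕ | GroverWalk.PSTOccurs G Φ Ψ τ} 12) := by
  refine ⟨Or.inl ⟨?_, ?_⟩, fun Φ Ψ hΦ hΨ ⟨τ, hτ⟩ => Or.inl ⟨?_, ?_⟩⟩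
  · obtain ⟨Φ, Ψ, hΦ, hΨ, τ, hτ⟩ := hpst
    exact ⟨Φ, Ψ, hΦ, hΨ, (hτ.mod_twelve hreg hspec hΦ hΨ).2⟩
  · rintro τ ⟨Φ, Ψ, hΦ, hΨ, hτ⟩
    have := (hτ.mod_twelve hreg hspec hΦ hΨ).1
    omega
  · exact (hτ.mod_twelve hreg hspec hΦ hΨ).2
  · intro σ hσ
    have := (GroverWalk.PSTOccurs.mod_twelve hreg hspec hΦ hΨ hσ).1
    omega
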